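/- For a finite simple connected graph $G$ with edge set $E(G)$, the Graovac--Ghorbani index is $$ABC_{GG}(G)=\sum_{uv\in E(G)}\sqrt{\frac{n_u+n_v-2}{n_u n_v}},$$ where, for an edge $uv$, $n_u$ is the number of vertices strictly closer to $u$ than to $v$ and $n_v$ is the number of vertices strictly closer to $v$ than to $u$. Let $B_1(n)$ be the family of graphs on $n$ vertices obtained from two vertex-disjoint cycles $C_p$ and $C_q$, with $p,q\ge 3$ and $p+q-1=n$, by identifying a vertex of $C_p$ with a vertex of $C_q$. Let $G\in B_1(n)$ with $n\ge 9$. If $n$ is odd, then $$ABC_{GG}(G)\ \ge\ \frac{2(n-3)}{\sqrt{n+1}}+2\sqrt{\frac{n-3}{n-2}}+\frac{2\sqrt{n-5}}{n-3}.$$ If $n$ is even, then $$ABC_{GG}(G)\ \ge\ 2\sqrt{\frac{n-3}{n-2}}+\frac{2(n-2)}{\sqrt{n+2}}.$$ In both cases equality holds if and only if $G$ is isomorphic to the graph obtained from a triangle $C_3$ and a disjoint cycle $C_{n-2}$ by identifying a vertex of one with a vertex of the other. -/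

import Mathlib

open scoped SimpleGraph

/-- The number `n_u` attached to an edge `uv`: how many vertices are strictly closer to `u`
than to `v`. -/
noncomputable def closerCount {V : Type*} (G : SimpleGraph V) (u v : V) : ℕ :=
  {w : V | G.dist w u < G.dist w v}.ncard

/-- The contribution of a pair `uv` to the Graovac-Ghorbani index. -/
noncomputable def edgeWeight {V : Type*} (G : SimpleGraph V) (u v : V) : ℝ :=
  Real.sqrt (((closerCount G u v : ℝ) + (closerCount G v u : ℝ) - 2) /
    ((closerCount G u v : ℝ) * (closerCount G v u : ℝ)))

theorem edgeWeight_comm {V : Type*} (G : SimpleGraph V) (u v : V) :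
    edgeWeight G u v = edgeWeight G v u := by
  unfold edgeWeight
  rw [add_comm (closerCount G u v : ℝ), mul_comm (closerCount G u v : ℝ)]

open scoped Classical in
/-- The Graovac-Ghorbani index: the sum of the weights over all (unordered) edges. -/
noncomputable def abcGG {V : Type*} [Fintype V] (G : SimpleGraph V) : ℝ :=
  ∑ e ∈ G.edgeFinset, Sym2.lift ⟨edgeWeight G, edgeWeight_comm G⟩ e

open scoped Classical in
/-- The map that identifies `v : W` with `u : V` in the disjoint union of `V` and `W`. -/
noncomputable def glueMap {V W : Type*} (u : V) (v : W) : V ⊕ W → V ⊕ {w : W // w ≠ v}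
  | Sum.inl x => Sum.inl x
  | Sum.inr y => if h : y = v then Sum.inl u else Sum.inr ⟨y, h⟩

/-- The graph obtained from the disjoint union of `G` and `H` by identifying the vertex `u` of
`G` with the vertex `v` of `H`. -/
noncomputable def glue {V W : Type*} (G : SimpleGraph V) (u : V) (H : SimpleGraph W) (v : W) :
    SimpleGraph (V ⊕ {w : W // w ≠ v}) :=
  (G ⊕g H).map (glueMap u v)

/-- `G` is (isomorphic to) a graph obtained from disjoint cycles `C_p` and `C_q` by identifying
a vertex of the first with a vertex of the second. -/
def IsGluedCycles {V : Type*} (p q : ℕ) (G : SimpleGraph V) : Prop :=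
  ∃ (u : Fin p) (v : Fin q),
    Nonempty (G ≃g glue (SimpleGraph.cycleGraph p) u (SimpleGraph.cycleGraph q) v)

/-- `G` belongs to the family `B₁(n)`. -/
def InB1 {V : Type*} (n : ℕ) (G : SimpleGraph V) : Prop :=
  ∃ p q : ℕ, 3 ≤ p ∧ 3 ≤ q ∧ p + q = n + 1 ∧ IsGluedCycles p q G

/-! Let C_p and C_q share one vertex. Every path from an edge of C_p to the rest of C_q passes
through it, so those q - 1 vertices all side with the end of the edge nearer the shared vertex.
Inside C_p each end claims a = ⌊p/2⌋ vertices. Hence 2a edges have counts a and a + q - 1; if p is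
odd, the opposite edge has counts a and a.

The 2a edges contribute 2√N √(a/D), with N = 2a + q - 3 and D = a + q - 1. Put b = ⌊q/2⌋ and m = a +
b. For odd q this is N = 2m - 2 and D = 2m - a; for even q both drop by one, which does not decrease
N/D when a ≥ 2. So for a, b ≥ 2 the index is at least 2√(2m - 2) (√(a/(2m - a)) + √(b/(2m - b)))
plus the opposite edges. By `add_sqrt_div_sub_le` the bracket is smallest at the most unbalanced
split.

If some cycle is odd, C_3 and C_{n-2} have the same m and realise the split 1, m - 1; the opposite
edge of a triangle has weight 0, that of a longer odd cycle is positive, and this gives strictness.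
Two even cycles have a larger m than the triangle pair, so `balanced_even_bound` compares the split
2, m - 2 with it numerically. -/

/-! ### One-point unions: distances and counts. -/

/-- `G` is the union of copies of `A` and `B` (embedded by `f` and `g`) that share exactly the
vertex `f u = g v`. -/
structure IsOnePointUnion {V W X : Type*} (A : SimpleGraph V) (B : SimpleGraph W)
    (G : SimpleGraph X) (f : V → X) (g : W → X) (u : V) (v : W) : Prop where
  inj_left : Function.Injective f
  inj_right : Function.Injective g
  eq_iff : ∀ a b, f a = g b ↔ a = u ∧ b = v
  surj : ∀ x, (∃ a, f a = x) ∨ ∃ b, g b = x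
  adj_iff : ∀ x y, G.Adj x y ↔
    (∃ a a', A.Adj a a' ∧ f a = x ∧ f a' = y) ∨ ∃ b b', B.Adj b b' ∧ g b = x ∧ g b' = y

theorem glue_isOnePointUnion {V W : Type*} (A : SimpleGraph V) (u : V) (B : SimpleGraph W)
    (v : W) : IsOnePointUnion A B (glue A u B v) Sum.inl (fun b => glueMap u v (Sum.inr b)) u v where
  inj_left := Sum.inl_injective
  inj_right := by
    intro b b' h
    simp only [glueMap] at h
    split_ifs at h <;> simp_all
  eq_iff a b := by
    simp only [glueMap]
    split_ifs <;> simp_all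
  surj x := by
    rcases x with a | ⟨b, hb⟩
    · exact Or.inl ⟨a, rfl⟩
    · exact Or.inr ⟨b, by simp [glueMap, hb]⟩
  adj_iff x y := by
    have hne : ∀ b b', B.Adj b b' →
        glueMap u v (Sum.inr b) ≠ glueMap u v (Sum.inr b') := by
      intro b b' h h'
      apply h.ne
      simp only [glueMap] at h'
      split_ifs at h' <;> simp_all
    have hne' : ∀ a a', A.Adj a a' →
        glueMap u v (Sum.inl a) ≠ glueMap u v (Sum.inl a') := by
      intro a a' h h'
      apply h.ne
      simpa [glueMap] using h'
    simp only [glue]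
    constructor
    · rintro ⟨_ , s, t, hst, rfl, rfl⟩
      rcases s with a | b <;> rcases t with a' | b'
      · exact Or.inl ⟨a, a', by simpa using hst, rfl, rfl⟩
      · simp at hst
      · simp at hst
      · exact Or.inr ⟨b, b', by simpa using hst, rfl, rfl⟩
    · rintro (⟨a, a', h, rfl, rfl⟩ | ⟨b, b', h, rfl, rfl⟩)
      · exact ⟨hne' _ _ h, .inl a, .inl a', by simpa using h, rfl, rfl⟩
      · exact ⟨hne _ _ h, .inr b, .inr b', by simpa using h, rfl, rfl⟩

/-- Source of the lower bounds on distances: a bound that survives each edge at the cost of one unit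
bounds the length of any walk. -/
theorem SimpleGraph.Walk.induction_on_length {X : Type*} {G : SimpleGraph X} (P : X → ℕ → Prop)
    (step : ∀ x y k, G.Adj x y → P x k → P y (k + 1)) {x y : X} (p : G.Walk x y) :
    ∀ k, P x k → P y (k + p.length) := by
  induction p with
  | nil => exact fun k hk => hk
  | cons h p ih =>
    intro k hk
    have := ih (k + 1) (step _ _ k h hk)
    rw [SimpleGraph.Walk.length_cons]
    convert this using 1
    omega

theorem SimpleGraph.Hom.dist_le {V X : Type*} {A : SimpleGraph V} {G : SimpleGraph X}
    (F : A →g G) (hA : A.Connected) (a a' : V) : G.dist (F a) (F a') ≤ A.dist a a' := by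
  obtain ⟨p, hp⟩ := hA.exists_walk_length_eq_dist a a'
  rw [← hp, ← SimpleGraph.Walk.length_map F p]
  exact SimpleGraph.dist_le _

namespace IsOnePointUnion

variable {V W X : Type*} {A : SimpleGraph V} {B : SimpleGraph W} {G : SimpleGraph X}
  {f : V → X} {g : W → X} {u : V} {v : W}

theorem symm (h : IsOnePointUnion A B G f g u v) : IsOnePointUnion B A G g f v u where
  inj_left := h.inj_right
  inj_right := h.inj_left
  eq_iff b a := by rw [eq_comm, h.eq_iff, and_comm]
  surj x := (h.surj x).symm
  adj_iff x y := by rw [h.adj_iff, or_comm]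

theorem comp_iso {Y : Type*} {G' : SimpleGraph Y} (h : IsOnePointUnion A B G f g u v)
    (e : G ≃g G') : IsOnePointUnion A B G' (e ∘ f) (e ∘ g) u v where
  inj_left := e.injective.comp h.inj_left
  inj_right := e.injective.comp h.inj_right
  eq_iff a b := by simp [h.eq_iff]
  surj y := by
    rcases h.surj (e.symm y) with ⟨a, ha⟩ | ⟨b, hb⟩
    · exact Or.inl ⟨a, by simp [ha]⟩
    · exact Or.inr ⟨b, by simp [hb]⟩
  adj_iff x y := by
    rw [← e.symm.map_adj_iff, h.adj_iff]
    have key : ∀ s t, s = e.symm t ↔ e s = t := fun s t => by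
      constructor
      · rintro rfl; simp
      · rintro rfl; simp
    simp only [key, Function.comp]

theorem eq_points (h : IsOnePointUnion A B G f g u v) : f u = g v := (h.eq_iff u v).2 ⟨rfl, rfl⟩

theorem nonempty_iso_glue (h : IsOnePointUnion A B G f g u v) : Nonempty (G ≃g glue A u B v) := by
  classical
  have h' := glue_isOnePointUnion A u B v
  let F : V ⊕ {w : W // w ≠ v} → X := Sum.elim f (fun w => g w.1)
  have hFg : ∀ b, F (glueMap u v (Sum.inr b)) = g b := by
    intro b
    simp only [glueMap]
    split_ifs with hb
    · rw [hb]; exact h.eq_points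
    · rfl
  have hF : Function.Bijective F := by
    constructor
    · rintro (a | ⟨b, hb⟩) (a' | ⟨b', hb'⟩) hab
      · exact congrArg _ (h.inj_left hab)
      · exact absurd ((h.eq_iff _ _).1 hab).2 hb'
      · exact absurd ((h.eq_iff _ _).1 hab.symm).2 hb
      · have := h.inj_right hab
        simp only at this
        subst this
        rfl
    · intro x
      rcases h.surj x with ⟨a, rfl⟩ | ⟨b, rfl⟩
      · exact ⟨.inl a, rfl⟩
      · exact ⟨_, hFg b⟩
  refine ⟨RelIso.symm ⟨Equiv.ofBijective F hF, ?_⟩⟩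
  intro x y
  have key : ∀ s t, s = F t ↔ (∀ t', F t' = s → t' = t) := fun s t => by
    constructor
    · rintro rfl t' ht'
      exact hF.1 ht'
    · intro ht
      obtain ⟨t', rfl⟩ := hF.2 s
      rw [ht t' rfl]
  simp only [Equiv.ofBijective_apply]
  rw [h.adj_iff, h'.adj_iff]
  have h1 : ∀ a t, f a = F t ↔ Sum.inl a = t := fun a t =>
    ⟨fun e => hF.1 e, fun e => by rw [← e]; rfl⟩
  have h2 : ∀ b t, g b = F t ↔ glueMap u v (Sum.inr b) = t := fun b t =>
    ⟨fun e => hF.1 (by rw [hFg, e]), fun e => by rw [← e, hFg]⟩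
  simp only [h1, h2]

/-- The homomorphism of the left part into the union. -/
def leftHom (h : IsOnePointUnion A B G f g u v) : A →g G :=
  ⟨f, fun {a a'} haa' => (h.adj_iff _ _).2 (Or.inl ⟨a, a', haa', rfl, rfl⟩)⟩

theorem connected (h : IsOnePointUnion A B G f g u v) (hA : A.Connected) (hB : B.Connected) :
    G.Connected := by
  have key : ∀ x, G.Reachable (f u) x := by
    intro x
    rcases h.surj x with ⟨a, rfl⟩ | ⟨b, rfl⟩
    · exact (hA.preconnected u a).map h.leftHom
    · rw [h.eq_points]
      exact (hB.preconnected v b).map h.symm.leftHom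
  have : Nonempty X := ⟨f u⟩
  exact ⟨fun x y => (key x).symm.trans (key y)⟩

/-- The claimed distance from `f a` grows by at most one along an edge of either part, and its two
descriptions agree at the shared vertex. -/
theorem le_length_walk (h : IsOnePointUnion A B G f g u v) (hA : A.Connected) (hB : B.Connected)
    (a : V) {y : X} (p : G.Walk (f a) y) :
    (∀ a', f a' = y → A.dist a a' ≤ p.length) ∧
      ∀ b, g b = y → A.dist a u + B.dist v b ≤ p.length := by
  have := SimpleGraph.Walk.induction_on_length
    (fun y k => (∀ a', f a' = y → A.dist a a' ≤ k) ∧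
      ∀ b, g b = y → A.dist a u + B.dist v b ≤ k) ?_ p 0 ?_
  · simpa using this
  · intro x y k hxy hk
    rcases (h.adj_iff _ _).1 hxy with ⟨a1, a2, h12, rfl, rfl⟩ | ⟨b1, b2, h12, rfl, rfl⟩
    · have h1 := hk.1 a1 rfl
      have h2 : A.dist a a2 ≤ A.dist a a1 + A.dist a1 a2 := hA.dist_triangle
      rw [SimpleGraph.dist_eq_one_iff_adj.2 h12] at h2
      refine ⟨fun a' ha' => ?_, fun b hb => ?_⟩
      · rw [h.inj_left ha']; omega
      · obtain ⟨rfl, rfl⟩ := (h.eq_iff _ _).1 hb.symm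
        simp; omega
    · have h1 := hk.2 b1 rfl
      have h2 : B.dist v b2 ≤ B.dist v b1 + B.dist b1 b2 := hB.dist_triangle
      rw [SimpleGraph.dist_eq_one_iff_adj.2 h12] at h2
      refine ⟨fun a' ha' => ?_, fun b hb => ?_⟩
      · obtain ⟨rfl, rfl⟩ := (h.eq_iff _ _).1 ha'
        omega
      · rw [h.inj_right hb]; omega
  · refine ⟨fun a' ha' => ?_, fun b hb => ?_⟩
    · rw [h.inj_left ha']; simp
    · obtain ⟨rfl, rfl⟩ := (h.eq_iff _ _).1 hb.symm
      simp

theorem dist_left (h : IsOnePointUnion A B G f g u v) (hA : A.Connected) (hB : B.Connected)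
    (a a' : V) : G.dist (f a) (f a') = A.dist a a' := by
  apply le_antisymm
  · exact h.leftHom.dist_le hA a a'
  · obtain ⟨p, hp⟩ := (h.connected hA hB).exists_walk_length_eq_dist (f a) (f a')
    rw [← hp]
    exact (h.le_length_walk hA hB a p).1 a' rfl

theorem dist_left_right (h : IsOnePointUnion A B G f g u v) (hA : A.Connected)
    (hB : B.Connected) (a : V) (b : W) : G.dist (f a) (g b) = A.dist a u + B.dist v b := by
  apply le_antisymm
  · rw [← h.dist_left hA hB, ← h.symm.dist_left hB hA, h.eq_points]
    exact (h.connected hA hB).dist_triangle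
  · obtain ⟨p, hp⟩ := (h.connected hA hB).exists_walk_length_eq_dist (f a) (g b)
    rw [← hp]
    exact (h.le_length_walk hA hB a p).2 b rfl

/-- From `g b` the distances to `f i` and `f j` are those from `u`, both increased by `B.dist v b`.
So all of `B` votes as `u` does; `v` is left out because it is already counted as `u` in `A`. -/
theorem closerCount_left [Finite V] [Finite W] (h : IsOnePointUnion A B G f g u v)
    (hA : A.Connected) (hB : B.Connected) (i j : V) :
    closerCount G (f i) (f j) =
      closerCount A i j + if A.dist u i < A.dist u j then Nat.card W - 1 else 0 := by
  have hset : {x : X | G.dist x (f i) < G.dist x (f j)} =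
      f '' {a | A.dist a i < A.dist a j} ∪
        g '' {b | b ≠ v ∧ A.dist u i < A.dist u j} := by
    ext x
    simp only [Set.mem_ofPred_eq, Set.mem_union, Set.mem_image]
    rcases h.surj x with ⟨a, rfl⟩ | ⟨b, rfl⟩
    · rw [h.dist_left hA hB, h.dist_left hA hB]
      constructor
      · exact fun ha => Or.inl ⟨a, ha, rfl⟩
      · rintro (⟨a', ha', e⟩ | ⟨b, hb, e⟩)
        · rwa [← h.inj_left e]
        · exact absurd ((h.eq_iff _ _).1 e.symm).2 hb.1
    · rw [G.dist_comm (u := g b), G.dist_comm (u := g b), h.dist_left_right hA hB,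
        h.dist_left_right hA hB, A.dist_comm (u := i), A.dist_comm (u := j)]
      constructor
      · intro hb
        by_cases hbv : b = v
        · subst hbv
          exact Or.inl ⟨u, by simpa using hb, h.eq_points⟩
        · exact Or.inr ⟨b, ⟨hbv, by omega⟩, rfl⟩
      · rintro (⟨a', ha', e⟩ | ⟨b', hb, e⟩)
        · obtain ⟨rfl, rfl⟩ := (h.eq_iff _ _).1 e
          omega
        · omega
  rw [closerCount, hset, Set.ncard_union_eq ?_ (Set.toFinite _) (Set.toFinite _),
    Set.ncard_image_of_injective _ h.inj_left, Set.ncard_image_of_injective _ h.inj_right]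
  · congr 1
    split_ifs with hu
    · simp only [hu, and_true]
      have : {b | b ≠ v} = ({v} : Set W)ᶜ := by ext; simp
      rw [this, Set.ncard_compl, Set.ncard_singleton]
    · simp [hu]
  · rw [Set.disjoint_left]
    rintro _ ⟨a, -, rfl⟩ ⟨b, hb, e⟩
    exact hb.1 ((h.eq_iff _ _).1 e.symm).2

end IsOnePointUnion

theorem isGluedCycles_iff {X : Type*} {p q : ℕ} {G : SimpleGraph X} :
    IsGluedCycles p q G ↔ ∃ f g u v,
      IsOnePointUnion (SimpleGraph.cycleGraph p) (SimpleGraph.cycleGraph q) G f g u v := by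
  constructor
  · rintro ⟨u, v, ⟨e⟩⟩
    exact ⟨_, _, u, v, (glue_isOnePointUnion _ u _ v).comp_iso e.symm⟩
  · rintro ⟨f, g, u, v, h⟩
    exact ⟨u, v, h.nonempty_iso_glue⟩

theorem IsGluedCycles.symm {X : Type*} {p q : ℕ} {G : SimpleGraph X} (h : IsGluedCycles p q G) :
    IsGluedCycles q p G := by
  obtain ⟨f, g, u, v, h⟩ := isGluedCycles_iff.1 h
  exact isGluedCycles_iff.2 ⟨g, f, v, u, h.symm⟩

/-! ### Two real inequalities. -/

/-- The square of the sum is 1 + 2t - 3t² with t = √(ab/(2m² + ab)). Here t increases with ab, and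
4ab ≤ m² gives t ≤ 1/3, the range where the quadratic increases. The least product ab is at the end
of the range. -/
theorem add_sqrt_div_sub_le {m c a b : ℝ} (hc : 0 < c) (hca : c ≤ a) (hcb : c ≤ b)
    (hab : a + b = m) :
    √(c / (2 * m - c)) + √((m - c) / (2 * m - (m - c))) ≤
      √(a / (2 * m - a)) + √(b / (2 * m - b)) := by
  have key : ∀ x y : ℝ, 0 < x → 0 < y → x + y = m →
      (√(x / (2 * m - x)) + √(y / (2 * m - y))) ^ 2 =
        1 + 2 * √(x * y / (2 * m ^ 2 + x * y)) - 3 * √(x * y / (2 * m ^ 2 + x * y)) ^ 2 := by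
    intro x y hx hy hxy
    have h1 : 0 < 2 * m - x := by linarith
    have h2 : 0 < 2 * m - y := by linarith
    have hm : 0 < 2 * m ^ 2 + x * y := by positivity
    have hD : (2 * m - x) * (2 * m - y) = 2 * m ^ 2 + x * y := by rw [← hxy]; ring
    rw [add_sq, Real.sq_sqrt (by positivity), Real.sq_sqrt (by positivity),
      Real.sq_sqrt (by positivity), mul_assoc, ← Real.sqrt_mul (by positivity),
      div_mul_div_comm, hD]
    have : x / (2 * m - x) + y / (2 * m - y) = 1 - 3 * (x * y / (2 * m ^ 2 + x * y)) := by
      rw [← hD]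
      field_simp
      rw [← hxy]; ring
    linarith
  have hp : c * (m - c) ≤ a * b := by
    have : a * b - c * (m - c) = (a - c) * (b - c) := by rw [← hab]; ring
    nlinarith [mul_nonneg (sub_nonneg.2 hca) (sub_nonneg.2 hcb)]
  have ha : 0 < a := by linarith
  have hb : 0 < b := by linarith
  have hm : 0 < m := by linarith
  have hmc : 0 < m - c := by linarith
  apply le_of_sq_le_sq _ (by positivity)
  rw [key a b ha hb hab, key c (m - c) hc hmc (by ring)]
  have hle : √(c * (m - c) / (2 * m ^ 2 + c * (m - c))) ≤ √(a * b / (2 * m ^ 2 + a * b)) := by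
    apply Real.sqrt_le_sqrt
    rw [div_le_div_iff₀ (by positivity) (by positivity)]
    nlinarith [mul_le_mul_of_nonneg_left hp (by positivity : 0 ≤ m ^ 2)]
  have hthird : √(a * b / (2 * m ^ 2 + a * b)) ≤ 1 / 3 := by
    apply Real.sqrt_le_iff.2 ⟨by norm_num, ?_⟩
    rw [div_le_iff₀ (by positivity), ← hab]
    nlinarith [sq_nonneg (a - b)]
  nlinarith

/-- With x = n + 1, the left side is half the triangle value for odd n and the right side half the
lower bound for two even cycles. The gap tends to √2 - 1. -/
theorem balanced_even_bound {x : ℝ} (hx : 10 ≤ x) :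
    √((x - 4) / (x - 3)) + (x - 4) / √x + √(x - 6) / (x - 4) <
      √2 + √((x - 2) * (x - 4) / (x + 4)) := by
  obtain ⟨s, hs0, rfl⟩ : ∃ s : ℝ, 0 < s ∧ x = s ^ 2 :=
    ⟨√x, by positivity, (Real.sq_sqrt (by linarith)).symm⟩
  rw [Real.sqrt_sq hs0.le]
  have h1 : √((s ^ 2 - 4) / (s ^ 2 - 3)) ≤ 1 := by
    apply Real.sqrt_le_one.2
    rw [div_le_one (by linarith)]; linarith
  -- x(x - 6)/(x - 4)² peaks at x = 12 with value 9/8, and 1.061 exceeds √(9/8).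
  have h2 : √(s ^ 2 - 6) / (s ^ 2 - 4) ≤ 1.061 / s := by
    rw [div_le_div_iff₀ (by linarith) hs0]
    apply le_of_sq_le_sq _ (by nlinarith)
    rw [mul_pow, Real.sq_sqrt (by linarith)]
    nlinarith [sq_nonneg (s ^ 2 - 12)]
  -- The root expands as s(1 - 5/s² + (23/2)/s⁴ + ...); lowering 23/2 to 8 makes it a bound for all
  -- s² ≥ 10.
  have h3 : (s ^ 2 - 5 + 8 / s ^ 2) / s ≤ √((s ^ 2 - 2) * (s ^ 2 - 4) / (s ^ 2 + 4)) := by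
    apply Real.le_sqrt_of_sq_le
    rw [div_pow, div_le_div_iff₀ (by positivity) (by positivity)]
    have h4 : s ^ 2 - 5 + 8 / s ^ 2 = (s ^ 4 - 5 * s ^ 2 + 8) / s ^ 2 := by
      field_simp
    rw [h4, div_pow, div_mul_eq_mul_div, div_le_iff₀ (by positivity)]
    obtain ⟨r, hr⟩ : ∃ r, s ^ 2 = r + 10 := ⟨s ^ 2 - 10, by ring⟩
    have hr0 : 0 ≤ r := by linarith
    rw [show s ^ 4 = (s ^ 2) ^ 2 by ring, hr]
    rw [← sub_nonneg]
    ring_nf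
    positivity
  have h5 : (1.414 : ℝ) < √2 := Real.lt_sqrt_of_sq_lt (by norm_num)
  have h6 : (s ^ 2 - 4) / s + 1.061 / s - (s ^ 2 - 5 + 8 / s ^ 2) / s < 0.414 := by
    have : (s ^ 2 - 4) / s + 1.061 / s - (s ^ 2 - 5 + 8 / s ^ 2) / s =
        (2.061 * s ^ 2 - 8) / s ^ 3 := by
      field_simp; ring
    rw [this, div_lt_iff₀ (by positivity)]
    -- 3.32 is near the minimiser of 0.414s³ - 2.061s² + 8 on s > 0.
    nlinarith [mul_nonneg hs0.le (sq_nonneg (s - 3.32)), sq_nonneg (s - 3.32)]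
  linarith

/-! ### Distances and counts in a cycle. -/

namespace SimpleGraph

theorem cycleGraph_adj_add_one {k : ℕ} (i : Fin (k + 3)) :
    (cycleGraph (k + 3)).Adj i (i + 1) := by
  rw [cycleGraph_adj]
  right
  simp

theorem cycleGraph_dist_le {k : ℕ} (i j : Fin (k + 3)) :
    (cycleGraph (k + 3)).dist i j ≤ (j - i).val := by
  generalize hm : (j - i).val = m
  induction m generalizing j with
  | zero =>
    have : j - i = 0 := Fin.ext hm
    rw [sub_eq_zero.1 this, dist_self]
  | succ m ih =>
    have h0 : j - i ≠ 0 := by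
      intro h
      rw [h] at hm
      simp at hm
    have h1 : (j - 1 - i).val = m := by
      rw [show j - 1 - i = j - i - 1 by abel, Fin.val_sub_one_of_ne_zero h0, hm,
        Nat.add_sub_cancel]
    have h2 := ih (j - 1) h1
    have h3 := cycleGraph_adj_add_one (j - 1)
    rw [sub_add_cancel, ← dist_eq_one_iff_adj] at h3
    have h4 : (cycleGraph (k + 3)).dist i j ≤ (cycleGraph (k + 3)).dist i (j - 1) +
        (cycleGraph (k + 3)).dist (j - 1) j := cycleGraph_connected.dist_triangle
    omega

theorem cycleGraph_dist {k : ℕ} (i j : Fin (k + 3)) :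
    (cycleGraph (k + 3)).dist i j = min (j - i).val (k + 3 - (j - i).val) := by
  apply le_antisymm
  · refine le_min (cycleGraph_dist_le i j) ?_
    by_cases hij : i = j
    · simp [hij]
    · have h1 := cycleGraph_dist_le j i
      rw [dist_comm] at h1
      have h2 : (i - j).val = k + 3 - (j - i).val := by
        have h3 : (i - j : Fin (k + 3)) = - (j - i) := by abel
        rw [h3, Fin.val_neg, if_neg]
        exact sub_ne_zero.2 (Ne.symm hij)
      omega
  · obtain ⟨p, hp⟩ := cycleGraph_connected.exists_walk_length_eq_dist i j
    rw [← hp]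
    -- An edge changes y - i by ±1 modulo k + 3, hence the minimum by at most one.
    have := Walk.induction_on_length
      (fun y m => min (y - i).val (k + 3 - (y - i).val) ≤ m) ?_ p 0 (by simp)
    · simpa using this
    · intro x y m hxy hm
      rw [cycleGraph_adj'] at hxy
      have hx := (x - i).isLt
      have hy := (y - i).isLt
      rcases hxy with h | h
      · have e : x - i = (y - i) + (x - y) := by abel
        have e' := Fin.val_add_eq_ite (y - i) (x - y)
        rw [← e, h] at e'
        split_ifs at e' <;> omega
      · have e : y - i = (x - i) + (y - x) := by abel
        have e' := Fin.val_add_eq_ite (x - i) (y - x)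
        rw [← e, h] at e'
        split_ifs at e' <;> omega

/-- Moving one step along the cycle compares distances according to the position on the cycle. -/
theorem cycleGraph_dist_lt_dist_add_one {k : ℕ} (w i : Fin (k + 3)) :
    (cycleGraph (k + 3)).dist w i < (cycleGraph (k + 3)).dist w (i + 1) ↔
      (i - w).val < (k + 3) / 2 := by
  rw [cycleGraph_dist, cycleGraph_dist, show i + 1 - w = (i - w) + 1 by abel,
    Fin.val_add_eq_ite]
  have := (i - w).isLt
  have h1 : (1 : Fin (k + 3)).val = 1 := rfl
  rw [h1]
  split_ifs <;> omega

theorem cycleGraph_dist_add_one_lt_dist {k : ℕ} (w i : Fin (k + 3)) :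
    (cycleGraph (k + 3)).dist w (i + 1) < (cycleGraph (k + 3)).dist w i ↔
      (k + 3) - (k + 3) / 2 ≤ (i - w).val := by
  rw [cycleGraph_dist, cycleGraph_dist, show i + 1 - w = (i - w) + 1 by abel,
    Fin.val_add_eq_ite]
  have := (i - w).isLt
  have h1 : (1 : Fin (k + 3)).val = 1 := rfl
  rw [h1]
  split_ifs <;> omega

end SimpleGraph

open SimpleGraph

theorem card_filter_fin_le_val (n m : ℕ) :
    (Finset.univ.filter fun z : Fin n => m ≤ z.val).card = n - m := by
  have h := Finset.card_filter_add_card_filter_not (s := (Finset.univ : Finset (Fin n)))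
    (fun z : Fin n => z.val < m)
  simp only [not_lt] at h
  rw [Fin.card_filter_val_lt, Finset.card_univ, Fintype.card_fin] at h
  omega

theorem closerCount_cycleGraph_add_one {k : ℕ} (i : Fin (k + 3)) :
    closerCount (cycleGraph (k + 3)) i (i + 1) = (k + 3) / 2 := by
  have : {w | (cycleGraph (k + 3)).dist w i < (cycleGraph (k + 3)).dist w (i + 1)} =
      (Equiv.subLeft i) ⁻¹' ((Finset.univ.filter fun z : Fin (k + 3) => z.val < (k + 3) / 2 :) :
        Set (Fin (k + 3))) := by
    ext w
    simp [cycleGraph_dist_lt_dist_add_one]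
  rw [closerCount, this, ← Equiv.image_symm_eq_preimage,
    Set.ncard_image_of_injective _ (Equiv.injective _), Set.ncard_coe_finset,
    Fin.card_filter_val_lt]
  omega

theorem closerCount_cycleGraph_add_one' {k : ℕ} (i : Fin (k + 3)) :
    closerCount (cycleGraph (k + 3)) (i + 1) i = (k + 3) / 2 := by
  have : {w | (cycleGraph (k + 3)).dist w (i + 1) < (cycleGraph (k + 3)).dist w i} =
      (Equiv.subLeft i) ⁻¹'
        ((Finset.univ.filter fun z : Fin (k + 3) => (k + 3) - (k + 3) / 2 ≤ z.val :) :
        Set (Fin (k + 3))) := by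
    ext w
    simp [cycleGraph_dist_add_one_lt_dist]
  rw [closerCount, this, ← Equiv.image_symm_eq_preimage,
    Set.ncard_image_of_injective _ (Equiv.injective _), Set.ncard_coe_finset,
    card_filter_fin_le_val]
  omega

/-! ### The index of two cycles sharing a vertex. -/

/-- The weight of an edge whose two counts are `x` and `y`. -/
noncomputable def countWeight (x y : ℕ) : ℝ := √(((x : ℝ) + y - 2) / (x * y))

theorem countWeight_comm (x y : ℕ) : countWeight x y = countWeight y x := by
  unfold countWeight
  rw [add_comm (x : ℝ), mul_comm (x : ℝ)]

/-- The contribution of the edges of `C_p` to the index of the union of `C_p` and `C_q`. -/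
noncomputable def cycleContribution (p q : ℕ) : ℝ :=
  (2 * (p / 2) : ℕ) * countWeight (p / 2) (p / 2 + (q - 1)) +
    (p % 2 : ℕ) * countWeight (p / 2) (p / 2)

namespace IsOnePointUnion

variable {X : Type*} {G : SimpleGraph X} {k l : ℕ} {f : Fin (k + 3) → X} {g : Fin (l + 3) → X}
  {u : Fin (k + 3)} {v : Fin (l + 3)}

/-- The two disjuncts say that the shared vertex is nearer to `f i`, respectively to `f (i + 1)`.
Neither holds only for the edge opposite to it in an odd cycle. -/
theorem edgeWeight_left
    (h : IsOnePointUnion (cycleGraph (k + 3)) (cycleGraph (l + 3)) G f g u v)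
    (i : Fin (k + 3)) :
    edgeWeight G (f i) (f (i + 1)) =
      if (i - u).val < (k + 3) / 2 ∨ (k + 3) - (k + 3) / 2 ≤ (i - u).val then
        countWeight ((k + 3) / 2) ((k + 3) / 2 + (l + 3 - 1))
      else countWeight ((k + 3) / 2) ((k + 3) / 2) := by
  have h1 : edgeWeight G (f i) (f (i + 1)) =
    countWeight (closerCount G (f i) (f (i + 1))) (closerCount G (f (i + 1)) (f i)) := rfl
  rw [h1, h.closerCount_left cycleGraph_connected cycleGraph_connected,
    h.closerCount_left cycleGraph_connected cycleGraph_connected,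
    closerCount_cycleGraph_add_one, closerCount_cycleGraph_add_one', Nat.card_fin]
  simp only [cycleGraph_dist_lt_dist_add_one, cycleGraph_dist_add_one_lt_dist]
  by_cases h2 : (i - u).val < (k + 3) / 2
  · have h3 : ¬ ((k + 3) - (k + 3) / 2 ≤ (i - u).val) := by omega
    simp only [h2, h3, if_true, if_false, add_zero, or_false]
    exact countWeight_comm _ _
  · by_cases h3 : (k + 3) - (k + 3) / 2 ≤ (i - u).val
    · simp only [h2, h3, if_true, if_false, add_zero, or_true]
    · simp only [h2, h3, if_false, add_zero, or_false]

theorem sum_edgeWeight_left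
    (h : IsOnePointUnion (cycleGraph (k + 3)) (cycleGraph (l + 3)) G f g u v) :
    ∑ i, edgeWeight G (f i) (f (i + 1)) = cycleContribution (k + 3) (l + 3) := by
  simp_rw [h.edgeWeight_left]
  -- Rotate the cycle so that the shared vertex sits at 0.
  rw [← Equiv.sum_comp (Equiv.addRight u)]
  simp only [Equiv.coe_addRight, add_sub_cancel_right]
  rw [Finset.sum_ite, Finset.sum_const, Finset.sum_const, nsmul_eq_mul, nsmul_eq_mul,
    cycleContribution]
  have h1 : (Finset.univ.filter fun z : Fin (k + 3) =>
      z.val < (k + 3) / 2 ∨ (k + 3) - (k + 3) / 2 ≤ z.val).card = 2 * ((k + 3) / 2) := by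
    rw [Finset.filter_or, Finset.card_union_of_disjoint, Fin.card_filter_val_lt,
      card_filter_fin_le_val]
    · omega
    · rw [Finset.disjoint_filter]
      intro z _ hz
      omega
  have h2 := Finset.card_filter_add_card_filter_not (s := (Finset.univ : Finset (Fin (k + 3))))
    (fun z : Fin (k + 3) => z.val < (k + 3) / 2 ∨ (k + 3) - (k + 3) / 2 ≤ z.val)
  rw [h1, Finset.card_univ, Fintype.card_fin] at h2
  rw [h1]
  congr 3
  omega

/-- The edges of the union of two cycles. -/
theorem edge_mem_iff
    (h : IsOnePointUnion (cycleGraph (k + 3)) (cycleGraph (l + 3)) G f g u v) (e : Sym2 X) :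
    e ∈ G.edgeSet ↔ (∃ i, s(f i, f (i + 1)) = e) ∨ ∃ j, s(g j, g (j + 1)) = e := by
  induction e with | _ x y => ?_
  rw [SimpleGraph.mem_edgeSet]
  have aux : ∀ {m : ℕ} (i j : Fin (m + 3)), (cycleGraph (m + 3)).Adj i j →
      j = i + 1 ∨ i = j + 1 := by
    intro m i j hij
    rw [cycleGraph_adj] at hij
    rcases hij with h1 | h1
    · right; rw [← h1]; abel
    · left; rw [← h1]; abel
  constructor
  · intro hxy
    rcases (h.adj_iff _ _).1 hxy with ⟨a, b, hab, rfl, rfl⟩ | ⟨a, b, hab, rfl, rfl⟩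
    · rcases aux _ _ hab with rfl | rfl
      · exact Or.inl ⟨a, rfl⟩
      · exact Or.inl ⟨b, Sym2.eq_swap⟩
    · rcases aux _ _ hab with rfl | rfl
      · exact Or.inr ⟨a, rfl⟩
      · exact Or.inr ⟨b, Sym2.eq_swap⟩
  · rw [← SimpleGraph.mem_edgeSet]
    rintro (⟨i, hi⟩ | ⟨i, hi⟩)
    · rw [← hi, SimpleGraph.mem_edgeSet]
      exact h.leftHom.map_adj (cycleGraph_adj_add_one i)
    · rw [← hi, SimpleGraph.mem_edgeSet]
      exact h.symm.leftHom.map_adj (cycleGraph_adj_add_one i)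

theorem edge_left_injective
    (h : IsOnePointUnion (cycleGraph (k + 3)) (cycleGraph (l + 3)) G f g u v) :
    Function.Injective fun i => s(f i, f (i + 1)) := by
  intro i j hij
  rcases Sym2.eq_iff.1 hij with ⟨h1, -⟩ | ⟨h1, h2⟩
  · exact h.inj_left h1
  · have h1 := h.inj_left h1
    have h2 := h.inj_left h2
    rw [h1, add_assoc] at h2
    -- A reversed match would force 2 = 0 modulo k + 3.
    have h3 : (1 + 1 : Fin (k + 3)) = 0 := by simpa using h2
    exact absurd (congrArg Fin.val h3) (by
      rw [Fin.val_add_eq_ite]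
      have h1 : (1 : Fin (k + 3)).val = 1 := rfl
      rw [h1, if_neg (by omega)]
      simp)

theorem edge_left_ne_right
    (h : IsOnePointUnion (cycleGraph (k + 3)) (cycleGraph (l + 3)) G f g u v) (i j) :
    s(f i, f (i + 1)) ≠ s(g j, g (j + 1)) := by
  intro hij
  have hne : i ≠ i + 1 := (cycleGraph_adj_add_one i).ne
  rcases Sym2.eq_iff.1 hij with ⟨h1, h2⟩ | ⟨h1, h2⟩ <;>
  · have h1 := ((h.eq_iff _ _).1 h1).1
    have h2 := ((h.eq_iff _ _).1 h2).1
    exact hne (h1.trans h2.symm)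

theorem abcGG_eq [Fintype X]
    (h : IsOnePointUnion (cycleGraph (k + 3)) (cycleGraph (l + 3)) G f g u v) :
    abcGG G = cycleContribution (k + 3) (l + 3) + cycleContribution (l + 3) (k + 3) := by
  classical
  rw [← h.sum_edgeWeight_left, ← h.symm.sum_edgeWeight_left]
  let E : Fin (k + 3) ⊕ Fin (l + 3) → Sym2 X :=
    Sum.elim (fun i => s(f i, f (i + 1))) fun j => s(g j, g (j + 1))
  have hE : Function.Injective E := by
    rintro (i | i) (j | j) hij
    · exact congrArg _ (h.edge_left_injective hij)
    · exact absurd hij (h.edge_left_ne_right i j)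
    · exact absurd hij.symm (h.edge_left_ne_right j i)
    · exact congrArg _ (h.symm.edge_left_injective hij)
  have himage : G.edgeFinset = Finset.univ.image E := by
    ext e
    rw [SimpleGraph.mem_edgeFinset, h.edge_mem_iff]
    simp [E]
  unfold abcGG
  convert (Finset.sum_image (s := Finset.univ) (g := E)
    (f := Sym2.lift ⟨edgeWeight G, edgeWeight_comm G⟩) (fun x _ y _ hxy => hE hxy)) using 1
  · convert rfl
    exact himage.symm
  · rw [Fintype.sum_sum_type]
    simp [E]

end IsOnePointUnion

theorem IsGluedCycles.abcGG_eq {X : Type*} [Fintype X] {G : SimpleGraph X} {p q : ℕ}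
    (hp : 3 ≤ p) (hq : 3 ≤ q) (h : IsGluedCycles p q G) :
    abcGG G = cycleContribution p q + cycleContribution q p := by
  obtain ⟨k, rfl⟩ := Nat.exists_eq_add_of_le' hp
  obtain ⟨l, rfl⟩ := Nat.exists_eq_add_of_le' hq
  obtain ⟨f, g, u, v, h⟩ := isGluedCycles_iff.1 h
  exact h.abcGG_eq

/-! ### Closed forms of the contributions. -/

theorem mul_sqrt_div_mul_self {a c d : ℝ} (ha : 0 ≤ a) (hc : 0 ≤ c) (hd : 0 ≤ d) :
    a * √(c / (a * d)) = √c * √(a / d) := by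
  rcases ha.eq_or_lt with rfl | ha'
  · simp
  · rw [← Real.sqrt_mul hc]
    nth_rewrite 1 [← Real.sqrt_sq ha]
    rw [← Real.sqrt_mul (by positivity)]
    congr 1
    rcases hd.eq_or_lt with rfl | hd'
    · simp
    · field_simp

theorem cycleContribution_even {a q : ℕ} (ha : 1 ≤ a) (hq : 1 ≤ q) :
    cycleContribution (2 * a) q =
      2 * (√(2 * a + q - 3) * √(a / (a + q - 1))) := by
  have ha' : (1 : ℝ) ≤ a := by exact_mod_cast ha
  have hq' : (1 : ℝ) ≤ q := by exact_mod_cast hq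
  have h1 : 2 * a / 2 = a := by omega
  have h2 : 2 * a % 2 = 0 := by omega
  rw [← mul_sqrt_div_mul_self (by linarith) (by linarith) (by linarith), cycleContribution, h1,
    h2, countWeight]
  push_cast [Nat.cast_sub hq]
  ring_nf

/-- The weight of the edge of an odd cycle `C_{2a+1}` opposite to the shared vertex. -/
noncomputable def oppositeWeight (a : ℝ) : ℝ := √(2 * a - 2) / a

theorem cycleContribution_odd {a q : ℕ} (ha : 1 ≤ a) (hq : 2 ≤ q) :
    cycleContribution (2 * a + 1) q =
      2 * (√(2 * a + q - 3) * √(a / (a + q - 1))) + oppositeWeight a := by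
  have ha' : (1 : ℝ) ≤ a := by exact_mod_cast ha
  have hq' : (2 : ℝ) ≤ q := by exact_mod_cast hq
  have h1 : (2 * a + 1) / 2 = a := by omega
  have h2 : (2 * a + 1) % 2 = 1 := by omega
  have h3 : countWeight a a = oppositeWeight a := by
    rw [countWeight, oppositeWeight, Real.sqrt_div (by linarith), Real.sqrt_mul_self (by linarith)]
    ring_nf
  rw [← mul_sqrt_div_mul_self (by linarith) (by linarith) (by linarith), cycleContribution, h1,
    h2, h3, countWeight]
  push_cast [Nat.cast_sub (show 1 ≤ q by omega)]
  ring_nf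

theorem oppositeWeight_one : oppositeWeight 1 = 0 := by
  norm_num [oppositeWeight]

theorem oppositeWeight_pos {a : ℝ} (ha : 1 < a) : 0 < oppositeWeight a := by
  have : 0 < 2 * a - 2 := by linarith
  unfold oppositeWeight
  positivity

/-- (2a - 2)/a² decreases only from a = 2 on; the value at 1 is 0. -/
theorem oppositeWeight_anti {a b : ℝ} (ha : 2 ≤ a) (hab : a ≤ b) :
    oppositeWeight b ≤ oppositeWeight a := by
  have h : ∀ c : ℝ, 2 ≤ c → oppositeWeight c = √((2 * c - 2) / c ^ 2) := by
    intro c hc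
    rw [Real.sqrt_div (by linarith), Real.sqrt_sq (by linarith), oppositeWeight]
  rw [h a ha, h b (ha.trans hab)]
  apply Real.sqrt_le_sqrt
  have hb : 0 < b := by linarith
  have ha0 : 0 < a := by linarith
  rw [div_le_div_iff₀ (by positivity) (by positivity)]
  have h1 : 0 ≤ a * b - a - b := by nlinarith
  nlinarith [mul_nonneg (sub_nonneg.2 hab) h1]

/-- The index of the union of `C_3` and `C_{n-2}`, for odd `n`. -/
theorem triangle_value_of_odd {n b : ℕ} (hb : 2 ≤ b) (hn : n = 2 * b + 3) :
    cycleContribution 3 (2 * b + 1) + cycleContribution (2 * b + 1) 3 =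
      2 * ((n : ℝ) - 3) / Real.sqrt ((n : ℝ) + 1)
          + 2 * Real.sqrt (((n : ℝ) - 3) / ((n : ℝ) - 2))
          + 2 * Real.sqrt ((n : ℝ) - 5) / ((n : ℝ) - 3) := by
  have hb' : (2 : ℝ) ≤ b := by exact_mod_cast hb
  have e := cycleContribution_odd (a := 1) (q := 2 * b + 1) le_rfl (by omega)
  rw [show 2 * 1 + 1 = 3 by rfl] at e
  rw [e, cycleContribution_odd (by omega) (by omega), hn]
  push_cast
  rw [oppositeWeight_one, oppositeWeight, ← Real.sqrt_mul (by linarith),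
    ← Real.sqrt_mul (by linarith)]
  have h1 : (2 * (b : ℝ) + 3 - 3) * (b / (b + 3 - 1)) = (2 * b) ^ 2 / (2 * b + 3 + 1) := by
    rw [← mul_div_assoc, div_eq_div_iff (ne_of_gt (by linarith)) (ne_of_gt (by linarith))]
    ring
  have h2 : (2 * 1 + (2 * (b : ℝ) + 1) - 3) * (1 / (1 + (2 * b + 1) - 1)) =
      (2 * b + 3 - 3) / (2 * b + 3 - 2) := by
    rw [mul_one_div]; congr 1 <;> ring
  rw [h1, h2, Real.sqrt_div (by linarith), Real.sqrt_div (by positivity),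
    Real.sqrt_sq (by positivity)]
  have h3 : 2 * (b : ℝ) - 2 = 2 * b + 3 - 5 := by ring
  rw [h3]
  field_simp
  ring

/-- The index of the union of `C_3` and `C_{n-2}`, for even `n`. -/
theorem triangle_value_of_even {n b : ℕ} (hb : 2 ≤ b) (hn : n = 2 * b + 2) :
    cycleContribution 3 (2 * b) + cycleContribution (2 * b) 3 =
      2 * Real.sqrt (((n : ℝ) - 3) / ((n : ℝ) - 2))
          + 2 * ((n : ℝ) - 2) / Real.sqrt ((n : ℝ) + 2) := by
  have hb' : (2 : ℝ) ≤ b := by exact_mod_cast hb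
  have e := cycleContribution_odd (a := 1) (q := 2 * b) le_rfl (by omega)
  rw [show 2 * 1 + 1 = 3 by rfl] at e
  rw [e, cycleContribution_even (by omega) (by omega), hn]
  push_cast
  rw [oppositeWeight_one, ← Real.sqrt_mul (by linarith),
    ← Real.sqrt_mul (by linarith)]
  have h1 : (2 * (b : ℝ) + 3 - 3) * (b / (b + 3 - 1)) = (2 * b) ^ 2 / (2 * b + 2 + 2) := by
    rw [← mul_div_assoc, div_eq_div_iff (ne_of_gt (by linarith)) (ne_of_gt (by linarith))]
    ring
  have h2 : (2 * 1 + 2 * (b : ℝ) - 3) * (1 / (1 + 2 * b - 1)) =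
      (2 * b + 2 - 3) / (2 * b + 2 - 2) := by
    rw [mul_one_div]; congr 1 <;> ring
  rw [h1, h2, Real.sqrt_div (by linarith), Real.sqrt_div (by positivity),
    Real.sqrt_sq (by positivity)]
  ring

/-! ### Comparison with the triangle. -/

theorem lt_of_odd_odd {a b c : ℕ} (ha : 2 ≤ a) (hb : 2 ≤ b) (hc : a + b = c + 1) :
    cycleContribution 3 (2 * c + 1) + cycleContribution (2 * c + 1) 3 <
      cycleContribution (2 * a + 1) (2 * b + 1) + cycleContribution (2 * b + 1) (2 * a + 1) := by
  have ha' : (2 : ℝ) ≤ a := by exact_mod_cast ha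
  have hb' : (2 : ℝ) ≤ b := by exact_mod_cast hb
  have hc' : (a : ℝ) + b = c + 1 := by exact_mod_cast hc
  have e := cycleContribution_odd (a := 1) (q := 2 * c + 1) le_rfl (by omega)
  rw [show 2 * 1 + 1 = 3 by rfl] at e
  rw [e, cycleContribution_odd (a := c) (by omega) (by omega),
    cycleContribution_odd (by omega) (by omega), cycleContribution_odd (by omega) (by omega)]
  push_cast
  have key := add_sqrt_div_sub_le one_pos (by linarith) (by linarith) hc'
  have h1 := oppositeWeight_anti hb' (show (b : ℝ) ≤ c by linarith)
  have h2 := oppositeWeight_pos (show (1 : ℝ) < a by linarith)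
  have hs := mul_le_mul_of_nonneg_left key (Real.sqrt_nonneg (2 * (c : ℝ)))
  rw [oppositeWeight_one]
  rw [show 2 * 1 + (2 * (c : ℝ) + 1) - 3 = 2 * c by ring, show 2 * (c : ℝ) + 3 - 3 = 2 * c by ring,
    show 2 * (a : ℝ) + (2 * b + 1) - 3 = 2 * c by linarith,
    show 2 * (b : ℝ) + (2 * a + 1) - 3 = 2 * c by linarith,
    show (a : ℝ) + (2 * b + 1) - 1 = 2 * (c + 1) - a by linarith,
    show (b : ℝ) + (2 * a + 1) - 1 = 2 * (c + 1) - b by linarith,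
    show 1 + (2 * (c : ℝ) + 1) - 1 = 2 * (c + 1) - 1 by linarith,
    show (c : ℝ) + 3 - 1 = 2 * (c + 1) - (c + 1 - 1) by linarith]
  rw [show (c : ℝ) + 1 - 1 = c by ring] at hs ⊢
  linarith

theorem lt_of_odd_even {a b c : ℕ} (ha : 2 ≤ a) (hb : 1 ≤ b) (hc : a + b = c + 1) :
    cycleContribution 3 (2 * c) + cycleContribution (2 * c) 3 <
      cycleContribution (2 * a + 1) (2 * b) + cycleContribution (2 * b) (2 * a + 1) := by
  have ha' : (2 : ℝ) ≤ a := by exact_mod_cast ha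
  have hb' : (1 : ℝ) ≤ b := by exact_mod_cast hb
  have hc' : (a : ℝ) + b = c + 1 := by exact_mod_cast hc
  have e := cycleContribution_odd (a := 1) (q := 2 * c) le_rfl (by omega)
  rw [show 2 * 1 + 1 = 3 by rfl] at e
  rw [e, cycleContribution_even (a := c) (by omega) (by omega),
    cycleContribution_odd (by omega) (by omega), cycleContribution_even (by omega) (by omega)]
  push_cast
  have key := add_sqrt_div_sub_le one_pos (by linarith) (by linarith) hc'
  have h2 := oppositeWeight_pos (show (1 : ℝ) < a by linarith)
  have hs := mul_le_mul_of_nonneg_left key (Real.sqrt_nonneg (2 * (c : ℝ)))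
  rw [oppositeWeight_one]
  have h3 : √(2 * (c : ℝ)) * √(a / (2 * (c + 1) - a)) ≤
      √(2 * (a : ℝ) + 2 * b - 3) * √(a / (a + 2 * b - 1)) := by
    rw [← Real.sqrt_mul (by linarith), ← Real.sqrt_mul (by linarith)]
    apply Real.sqrt_le_sqrt
    rw [← mul_div_assoc, ← mul_div_assoc, div_le_div_iff₀ (by linarith) (by linarith),
      show (c : ℝ) = a + b - 1 by linarith]
    nlinarith [mul_nonneg (show (0 : ℝ) ≤ a by linarith) (sub_nonneg.2 ha')]
  -- For the triangle a = 1, so lowering N and D by one works in the opposite direction, as needed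
  -- on this side.
  have h4 : √(2 * 1 + 2 * (c : ℝ) - 3) * √(1 / (1 + 2 * c - 1)) ≤
      √(2 * (c : ℝ)) * √(1 / (2 * (c + 1) - 1)) := by
    rw [← Real.sqrt_mul (by linarith), ← Real.sqrt_mul (by linarith)]
    apply Real.sqrt_le_sqrt
    rw [← mul_div_assoc, ← mul_div_assoc, div_le_div_iff₀ (by linarith) (by linarith)]
    nlinarith
  rw [show 2 * (c : ℝ) + 3 - 3 = 2 * c by ring,
    show 2 * (b : ℝ) + (2 * a + 1) - 3 = 2 * c by linarith,
    show (b : ℝ) + (2 * a + 1) - 1 = 2 * (c + 1) - b by linarith,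
    show (c : ℝ) + 3 - 1 = 2 * (c + 1) - (c + 1 - 1) by linarith]
  rw [show (c : ℝ) + 1 - 1 = c by ring] at hs ⊢
  linarith

theorem lt_of_even_even {a b c : ℕ} (ha : 2 ≤ a) (hb : 2 ≤ b) (hc : a + b = c + 2)
    (hc3 : 3 ≤ c) :
    cycleContribution 3 (2 * c + 1) + cycleContribution (2 * c + 1) 3 <
      cycleContribution (2 * a) (2 * b) + cycleContribution (2 * b) (2 * a) := by
  have ha' : (2 : ℝ) ≤ a := by exact_mod_cast ha
  have hb' : (2 : ℝ) ≤ b := by exact_mod_cast hb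
  have hc3' : (3 : ℝ) ≤ c := by exact_mod_cast hc3
  have hc' : (a : ℝ) + b = c + 2 := by exact_mod_cast hc
  rw [triangle_value_of_odd (n := 2 * c + 3) (by omega) rfl,
    cycleContribution_even (by omega) (by omega), cycleContribution_even (by omega) (by omega)]
  push_cast
  -- Even cycles have halves at least 2, so the extreme split is 2, c; starting from 1 would be
  -- weaker.
  have key := add_sqrt_div_sub_le two_pos ha' hb' hc'
  have hs := mul_le_mul_of_nonneg_left key (Real.sqrt_nonneg (2 * (c : ℝ) + 2))
  have aux : ∀ x y : ℝ, 2 ≤ x → 2 ≤ y → x + y = c + 2 →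
      √(2 * (c : ℝ) + 2) * √(x / (2 * (c + 2) - x)) ≤
        √(2 * x + 2 * y - 3) * √(x / (x + 2 * y - 1)) := by
    intro x y hx hy hxy
    rw [← Real.sqrt_mul (by linarith), ← Real.sqrt_mul (by linarith)]
    apply Real.sqrt_le_sqrt
    rw [← mul_div_assoc, ← mul_div_assoc, div_le_div_iff₀ (by linarith) (by linarith),
      show (c : ℝ) = x + y - 2 by linarith]
    nlinarith [mul_nonneg (show (0 : ℝ) ≤ x by linarith) (sub_nonneg.2 hx)]
  have h1 := aux a b ha' hb' hc'
  have h2 := aux b a hb' ha' (by linarith)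
  have h3 := balanced_even_bound (x := 2 * (c : ℝ) + 4) (by linarith)
  have h4 : √(2 * (c : ℝ) + 2) * √(2 / (2 * (c + 2) - 2)) = √2 := by
    rw [← Real.sqrt_mul (by linarith)]
    congr 1
    rw [← mul_div_assoc, div_eq_iff (ne_of_gt (by linarith))]
    ring
  have h5 : √(2 * (c : ℝ) + 2) * √((c + 2 - 2) / (2 * (c + 2) - (c + 2 - 2))) =
      √((2 * c + 4 - 2) * (2 * c + 4 - 4) / (2 * c + 4 + 4)) := by
    rw [← Real.sqrt_mul (by linarith)]
    congr 1
    rw [← mul_div_assoc, div_eq_div_iff (ne_of_gt (by linarith)) (ne_of_gt (by linarith))]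
    ring
  rw [mul_add, h4, h5] at hs
  rw [show 2 * (c : ℝ) + 3 + 1 = 2 * c + 4 by ring, show 2 * (c : ℝ) + 3 - 3 = 2 * c by ring,
    show 2 * (c : ℝ) + 3 - 2 = 2 * c + 1 by ring, show 2 * (c : ℝ) + 3 - 5 = 2 * c - 2 by ring,
    mul_div_assoc 2 (2 * (c : ℝ)), mul_div_assoc 2 √(2 * (c : ℝ) - 2)]
  rw [show 2 * (c : ℝ) + 4 - 4 = 2 * c by ring, show 2 * (c : ℝ) + 4 - 3 = 2 * c + 1 by ring,
    show 2 * (c : ℝ) + 4 - 6 = 2 * c - 2 by ring] at h3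
  rw [show 2 * (c : ℝ) + 4 - 4 = 2 * c by ring] at hs
  linarith

/-- Among the unions of two cycles on at least nine vertices, the triangle is strictly optimal. -/
theorem triangle_lt {n p q : ℕ} (hn : 9 ≤ n) (hp : 4 ≤ p) (hq : 4 ≤ q) (hpq : p + q = n + 1) :
    cycleContribution 3 (n - 2) + cycleContribution (n - 2) 3 <
      cycleContribution p q + cycleContribution q p := by
  obtain ⟨a, rfl | rfl⟩ := Nat.even_or_odd' p <;> obtain ⟨b, rfl | rfl⟩ := Nat.even_or_odd' q
  · rw [show n - 2 = 2 * (a + b - 2) + 1 by omega]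
    exact lt_of_even_even (by omega) (by omega) (by omega) (by omega)
  · rw [show n - 2 = 2 * (a + b - 1) by omega, add_comm (cycleContribution (2 * a) _)]
    exact lt_of_odd_even (by omega) (by omega) (by omega)
  · rw [show n - 2 = 2 * (a + b - 1) by omega]
    exact lt_of_odd_even (by omega) (by omega) (by omega)
  · rw [show n - 2 = 2 * (a + b - 1) + 1 by omega]
    exact lt_of_odd_odd (by omega) (by omega) (by omega)

theorem InB1.triangle_le {V : Type*} [Fintype V] {G : SimpleGraph V} {n : ℕ} (hn : 9 ≤ n)
    (hG : InB1 n G) :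
    cycleContribution 3 (n - 2) + cycleContribution (n - 2) 3 ≤ abcGG G ∧
      (abcGG G = cycleContribution 3 (n - 2) + cycleContribution (n - 2) 3 ↔
        IsGluedCycles 3 (n - 2) G) := by
  have hval : IsGluedCycles 3 (n - 2) G →
      abcGG G = cycleContribution 3 (n - 2) + cycleContribution (n - 2) 3 :=
    fun h => h.abcGG_eq le_rfl (by omega)
  suffices h : IsGluedCycles 3 (n - 2) G ∨
      cycleContribution 3 (n - 2) + cycleContribution (n - 2) 3 < abcGG G by
    rcases h with h | h
    · exact ⟨(hval h).ge, fun _ => h, hval⟩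
    · exact ⟨h.le, fun e => absurd e h.ne', hval⟩
  obtain ⟨p, q, hp, hq, hpq, h⟩ := hG
  by_cases hp3 : p = 3
  · left
    rwa [hp3, show q = n - 2 by omega] at h
  by_cases hq3 : q = 3
  · left
    have h := h.symm
    rwa [hq3, show p = n - 2 by omega] at h
  · right
    rw [h.abcGG_eq hp hq]
    exact triangle_lt hn (by omega) (by omega) hpq

theorem theorem1 {V : Type*} [Fintype V] (G : SimpleGraph V) (n : ℕ) (hn : 9 ≤ n)
    (hG : InB1 n G) :
    (Odd n →
      2 * ((n : ℝ) - 3) / Real.sqrt ((n : ℝ) + 1)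
          + 2 * Real.sqrt (((n : ℝ) - 3) / ((n : ℝ) - 2))
          + 2 * Real.sqrt ((n : ℝ) - 5) / ((n : ℝ) - 3) ≤ abcGG G ∧
      (abcGG G = 2 * ((n : ℝ) - 3) / Real.sqrt ((n : ℝ) + 1)
          + 2 * Real.sqrt (((n : ℝ) - 3) / ((n : ℝ) - 2))
          + 2 * Real.sqrt ((n : ℝ) - 5) / ((n : ℝ) - 3) ↔ IsGluedCycles 3 (n - 2) G)) ∧
    (Even n →
      2 * Real.sqrt (((n : ℝ) - 3) / ((n : ℝ) - 2))
          + 2 * ((n : ℝ) - 2) / Real.sqrt ((n : ℝ) + 2) ≤ abcGG G ∧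
      (abcGG G = 2 * Real.sqrt (((n : ℝ) - 3) / ((n : ℝ) - 2))
          + 2 * ((n : ℝ) - 2) / Real.sqrt ((n : ℝ) + 2) ↔ IsGluedCycles 3 (n - 2) G)) := by
  have h := hG.triangle_le hn
  constructor
  · rintro ⟨k, hk⟩
    rw [show n - 2 = 2 * (k - 1) + 1 by omega,
      triangle_value_of_odd (n := n) (by omega) (by omega)] at h
    rwa [show n - 2 = 2 * (k - 1) + 1 by omega]
  · rintro ⟨k, hk⟩
    rw [show n - 2 = 2 * (k - 1) by omega,
      triangle_value_of_even (n := n) (by omega) (by omega)] at h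
    rwa [show n - 2 = 2 * (k - 1) by omega]
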